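/- Let $M$ be a smooth (Hausdorff, finite-dimensional, boundaryless) manifold; all functions, forms and tensor fields are $C^\infty$. Let $\chi(M)$ be the space of vector fields and $\Omega^1(M)$ the space of 1-forms. A bivector field $\Lambda$ is identified with the skew-symmetric bundle map $\Lambda : T^*M \to TM$ given by $\langle \beta, \Lambda\alpha\rangle = \Lambda(\alpha,\beta)$; for a $(1,1)$-tensor field $J$ the transpose is ${}^tJ\alpha = \alpha\circ J$; $L_X = i_X d + d\, i_X$ is the Lie derivative of forms; $[\cdot,\cdot]$ is the Lie, respectively Schouten–Nijenhuis, bracket. Definitions. (1) A bivector field $\pi$ is a *Poisson tensor* if $[\pi,\pi]=0$. It is *homogeneous* with respect to a vector field $Z$ if $[Z,\pi]=-\pi$, where $[Z,\pi](\alpha,\beta)=Z(\pi(\alpha,\beta))-\pi(L_Z\alpha,\beta)-\pi(\alpha,L_Z\beta)$; if moreover $\pi$ is Poisson, then $(M,\pi,Z)$ is a *homogeneous Poisson manifold*. (2) A $(1,1)$-tensor field $J$ is a *Nijenhuis tensor* if $[JX,JY]-J[JX,Y]-J[X,JY]+J^2[X,Y]=0$ for all $X,Y\in\chi(M)$. (3)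 $\pi$ and $J$ are *compatible* if $J\circ\pi=\pi\circ{}^tJ$ and $C(\pi,J)=0$, where $$C(\pi,J)(\alpha,\beta)=\{\alpha,\beta\}_{J\pi}-\big(\{{}^tJ\alpha,\beta\}_\pi+\{\alpha,{}^tJ\beta\}_\pi-{}^tJ\{\alpha,\beta\}_\pi\big),\qquad \{\alpha,\beta\}_\Lambda=L_{\Lambda\alpha}\beta-L_{\Lambda\beta}\alpha-d(\Lambda(\alpha,\beta)).$$ (4) $(M,\pi,J)$ is a *Poisson–Nijenhuis manifold* if $\pi$ is a Poisson tensor, $J$ is a Nijenhuis tensor, and $\pi$ and $J$ are compatible. (5) $(M,\pi,J)$ is a *homogeneous Poisson–Nijenhuis manifold with respect to $Z$* if $(M,\pi,Z)$ is a homogeneous Poisson manifold, $J$ is a Nijenhuis tensor compatible with $\pi$, and $$\pi\circ(L_Z\circ{}^tJ-{}^tJ\circ L_Z)=0\quad\text{on }\Omega^1(M).$$ Statement. Let $(M,\pi,J)$ be a Poisson–Nijenhuis manifold and let $Z$ be a vector field on $M$ such that $\pi$ is homogeneous with respect to $Z$. If $[Z,JX]=J[Z,X]$ for all $X\in\chi(M)$,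 then $(M,\pi,J)$ is a homogeneous Poisson–Nijenhuis manifold with respect to $Z$. -/

import Mathlib

open scoped Manifold ContDiff

noncomputable section

namespace PoissonNijenhuis

section Fields

variable (E : Type*) [NormedAddCommGroup E] [NormedSpace ℝ E]
  (M : Type*) [TopologicalSpace M] [ChartedSpace E M]

/-- Smooth real valued functions on the manifold `M` (without boundary, modelled on `E`). -/
abbrev SmoothFunction : Type _ := C^∞⟮𝓘(ℝ, E), M; ℝ⟯

variable [IsManifold 𝓘(ℝ, E) ∞ M]

/-- Smooth vector fields: smooth sections of the tangent bundle. -/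
abbrev VectorField : Type _ :=
  Cₛ^∞⟮𝓘(ℝ, E); E, fun x : M => TangentSpace 𝓘(ℝ, E) x⟯

/-- Smooth differential 1-forms: smooth sections of the cotangent bundle. -/
abbrev OneForm : Type _ :=
  Cₛ^∞⟮𝓘(ℝ, E); E →L[ℝ] ℝ, fun x : M => TangentSpace 𝓘(ℝ, E) x →L[ℝ] ℝ⟯

/-- Smooth (1,1)-tensor fields: smooth sections of the endomorphism bundle of `TM`. -/
abbrev TensorField : Type _ :=
  Cₛ^∞⟮𝓘(ℝ, E); E →L[ℝ] E,
    fun x : M => TangentSpace 𝓘(ℝ, E) x →L[ℝ] TangentSpace 𝓘(ℝ, E) x⟯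

/-- Smooth bivector fields, given as smooth bundle maps `Λ : T*M → TM` that are skew-symmetric;
the corresponding bilinear form on covectors is `Λ(a, b) = ⟨b, Λ a⟩`. -/
structure BivectorField where
  /-- The underlying smooth bundle map `T*M → TM`. -/
  sharp : Cₛ^∞⟮𝓘(ℝ, E); (E →L[ℝ] ℝ) →L[ℝ] E,
    fun x : M => (TangentSpace 𝓘(ℝ, E) x →L[ℝ] ℝ) →L[ℝ] TangentSpace 𝓘(ℝ, E) x⟯
  skew : ∀ (x : M) (a b : TangentSpace 𝓘(ℝ, E) x →L[ℝ] ℝ),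
    b (sharp x a) = - a (sharp x b)

end Fields

section Operators

/-! The operators of this section are defined on arbitrary sections (families of vectors,
covectors, ...) and have their usual meaning on smooth ones. -/

variable {E : Type*} [NormedAddCommGroup E] [NormedSpace ℝ E]
  {M : Type*} [TopologicalSpace M] [ChartedSpace E M]

/-- The Lie bracket `[X, Y]` of vector fields. -/
abbrev bracket (X Y : ∀ x : M, TangentSpace 𝓘(ℝ, E) x) (x : M) : TangentSpace 𝓘(ℝ, E) x :=
  VectorField.mlieBracket 𝓘(ℝ, E) X Y x

/-- The differential `df` of a function. -/
def dFun (f : M → ℝ) (x : M) : TangentSpace 𝓘(ℝ, E) x →L[ℝ] ℝ :=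
  mfderiv 𝓘(ℝ, E) 𝓘(ℝ, ℝ) f x

/-- The expression of a 1-form in the preferred chart `φ` at `x`, that is `(φ⁻¹)^* α`. -/
def formInChart (α : ∀ x : M, TangentSpace 𝓘(ℝ, E) x →L[ℝ] ℝ) (x : M) (y : E) : E →L[ℝ] ℝ :=
  (α ((extChartAt 𝓘(ℝ, E) x).symm y)).comp
    (mfderiv 𝓘(ℝ, E) 𝓘(ℝ, E) (extChartAt 𝓘(ℝ, E) x).symm y)

/-- The exterior derivative `dα` of a 1-form at `x`, as a bilinear form on the tangent space at
`x`. It is computed in the preferred chart `φ` at `x`: with `a = (φ⁻¹)^* α`,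
`dα(u, v) = (D a)(φ_* u)(φ_* v) - (D a)(φ_* v)(φ_* u)`. -/
def dForm (α : ∀ x : M, TangentSpace 𝓘(ℝ, E) x →L[ℝ] ℝ) (x : M) :
    TangentSpace 𝓘(ℝ, E) x →L[ℝ] TangentSpace 𝓘(ℝ, E) x →L[ℝ] ℝ :=
  let D : E →L[ℝ] E →L[ℝ] ℝ := fderiv ℝ (formInChart α x) (extChartAt 𝓘(ℝ, E) x x)
  let p : E →L[ℝ] E := mfderiv 𝓘(ℝ, E) 𝓘(ℝ, E) (extChartAt 𝓘(ℝ, E) x) x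
  let B : E →L[ℝ] E →L[ℝ] ℝ := (D - D.flip).bilinearComp p p
  B

/-- The Lie derivative of 1-forms, `L_X α = i_X dα + d(i_X α)`. -/
def lieForm (X : ∀ x : M, TangentSpace 𝓘(ℝ, E) x)
    (α : ∀ x : M, TangentSpace 𝓘(ℝ, E) x →L[ℝ] ℝ) (x : M) : TangentSpace 𝓘(ℝ, E) x →L[ℝ] ℝ :=
  dForm α x (X x) + dFun (fun y => α y (X y)) x

/-- The transpose of a (1,1)-tensor field acting on 1-forms, `ᵗJ α = α ∘ J`. -/
def transpose (J : ∀ x : M, TangentSpace 𝓘(ℝ, E) x →L[ℝ] TangentSpace 𝓘(ℝ, E) x)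
    (α : ∀ x : M, TangentSpace 𝓘(ℝ, E) x →L[ℝ] ℝ) (x : M) : TangentSpace 𝓘(ℝ, E) x →L[ℝ] ℝ :=
  (α x).comp (J x)

/-- The function `Λ(α, β) = ⟨β, Λ α⟩`. -/
def pair (Λ : ∀ x : M, (TangentSpace 𝓘(ℝ, E) x →L[ℝ] ℝ) →L[ℝ] TangentSpace 𝓘(ℝ, E) x)
    (α β : ∀ x : M, TangentSpace 𝓘(ℝ, E) x →L[ℝ] ℝ) (x : M) : ℝ :=
  β x (Λ x (α x))

/-- The bracket of 1-forms `{α, β}_Λ = L_{Λα} β - L_{Λβ} α - d(Λ(α, β))`. -/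
def formBracket (Λ : ∀ x : M, (TangentSpace 𝓘(ℝ, E) x →L[ℝ] ℝ) →L[ℝ] TangentSpace 𝓘(ℝ, E) x)
    (α β : ∀ x : M, TangentSpace 𝓘(ℝ, E) x →L[ℝ] ℝ) (x : M) : TangentSpace 𝓘(ℝ, E) x →L[ℝ] ℝ :=
  lieForm (fun y => Λ y (α y)) β x - lieForm (fun y => Λ y (β y)) α x - dFun (pair Λ α β) x

/-- The concomitant
`C(Λ, J)(α, β) = {α, β}_{JΛ} - ({ᵗJα, β}_Λ + {α, ᵗJβ}_Λ - ᵗJ{α, β}_Λ)`. -/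
def concomitant
    (Λ : ∀ x : M, (TangentSpace 𝓘(ℝ, E) x →L[ℝ] ℝ) →L[ℝ] TangentSpace 𝓘(ℝ, E) x)
    (J : ∀ x : M, TangentSpace 𝓘(ℝ, E) x →L[ℝ] TangentSpace 𝓘(ℝ, E) x)
    (α β : ∀ x : M, TangentSpace 𝓘(ℝ, E) x →L[ℝ] ℝ) (x : M) : TangentSpace 𝓘(ℝ, E) x →L[ℝ] ℝ :=
  formBracket (fun y => (J y).comp (Λ y)) α β x
    - (formBracket Λ (transpose J α) β x + formBracket Λ α (transpose J β) x
      - transpose J (formBracket Λ α β) x)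

/-- The Nijenhuis torsion `N_J(X, Y) = [JX, JY] - J[JX, Y] - J[X, JY] + J²[X, Y]`. -/
def torsion (J : ∀ x : M, TangentSpace 𝓘(ℝ, E) x →L[ℝ] TangentSpace 𝓘(ℝ, E) x)
    (X Y : ∀ x : M, TangentSpace 𝓘(ℝ, E) x) (x : M) : TangentSpace 𝓘(ℝ, E) x :=
  bracket (fun y => J y (X y)) (fun y => J y (Y y)) x
    - J x (bracket (fun y => J y (X y)) Y x) - J x (bracket X (fun y => J y (Y y)) x)
    + J x (J x (bracket X Y x))

/-- The Schouten-Nijenhuis bracket of two bivector fields, evaluated on exact 1-forms (which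
determines it):
`[P, Q](df, dg, dh) = ∑_{cyc} (P(d(Q(df, dg)), dh) + Q(d(P(df, dg)), dh))`. -/
def schouten (P Q : ∀ x : M, (TangentSpace 𝓘(ℝ, E) x →L[ℝ] ℝ) →L[ℝ] TangentSpace 𝓘(ℝ, E) x)
    (f g h : M → ℝ) (x : M) : ℝ :=
  let c : (M → ℝ) → (M → ℝ) → (M → ℝ) → ℝ := fun f₁ f₂ f₃ =>
    pair P (dFun (pair Q (dFun f₁) (dFun f₂))) (dFun f₃) x
      + pair Q (dFun (pair P (dFun f₁) (dFun f₂))) (dFun f₃) x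
  c f g h + c g h f + c h f g

/-- The Schouten-Nijenhuis bracket of a vector field and a bivector field, i.e. the Lie
derivative `[Z, Λ](α, β) = Z(Λ(α, β)) - Λ(L_Z α, β) - Λ(α, L_Z β)`. -/
def lieBivector (Z : ∀ x : M, TangentSpace 𝓘(ℝ, E) x)
    (Λ : ∀ x : M, (TangentSpace 𝓘(ℝ, E) x →L[ℝ] ℝ) →L[ℝ] TangentSpace 𝓘(ℝ, E) x)
    (α β : ∀ x : M, TangentSpace 𝓘(ℝ, E) x →L[ℝ] ℝ) (x : M) : ℝ :=
  dFun (pair Λ α β) x (Z x) - pair Λ (lieForm Z α) β x - pair Λ α (lieForm Z β) x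

end Operators

section Structures

variable {E : Type*} [NormedAddCommGroup E] [NormedSpace ℝ E]
  {M : Type*} [TopologicalSpace M] [ChartedSpace E M] [IsManifold 𝓘(ℝ, E) ∞ M]

/-- `π` is a Poisson tensor: `[π, π] = 0`. -/
def IsPoisson (π : BivectorField E M) : Prop :=
  ∀ (f g h : SmoothFunction E M) (x : M), schouten π.sharp π.sharp f g h x = 0

/-- `J` is a Nijenhuis tensor: its Nijenhuis torsion vanishes. -/
def IsNijenhuis (J : TensorField E M) : Prop :=
  ∀ (X Y : VectorField E M) (x : M), torsion J X Y x = 0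

/-- `π` and `J` are compatible: `J ∘ π = π ∘ ᵗJ` and `C(π, J) = 0`. -/
structure Compatible (π : BivectorField E M) (J : TensorField E M) : Prop where
  comm : ∀ (α : OneForm E M) (x : M), J x (π.sharp x (α x)) = π.sharp x (transpose J α x)
  concomitant_eq_zero : ∀ (α β : OneForm E M) (x : M), concomitant π.sharp J α β x = 0

/-- `(M, π, J)` is a Poisson-Nijenhuis manifold. -/
structure IsPoissonNijenhuis (π : BivectorField E M) (J : TensorField E M) : Prop where
  poisson : IsPoisson π
  nijenhuis : IsNijenhuis J
  compatible : Compatible π J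

/-- `π` is homogeneous with respect to `Z`: `[Z, π] = -π`. -/
def IsHomogeneous (π : BivectorField E M) (Z : VectorField E M) : Prop :=
  ∀ (α β : OneForm E M) (x : M), lieBivector Z π.sharp α β x = - pair π.sharp α β x

/-- `(M, π, Z)` is a homogeneous Poisson manifold. -/
structure IsHomogeneousPoisson (π : BivectorField E M) (Z : VectorField E M) : Prop where
  poisson : IsPoisson π
  homogeneous : IsHomogeneous π Z

/-- `(M, π, J)` is a homogeneous Poisson-Nijenhuis manifold with respect to `Z`: `(M, π, Z)` is a
homogeneous Poisson manifold, `J` is a Nijenhuis tensor compatible with `π`, and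
`π ∘ (L_Z ∘ ᵗJ - ᵗJ ∘ L_Z) = 0` on 1-forms. -/
structure IsHomogeneousPoissonNijenhuis (π : BivectorField E M) (J : TensorField E M)
    (Z : VectorField E M) : Prop where
  homogeneousPoisson : IsHomogeneousPoisson π Z
  nijenhuis : IsNijenhuis J
  compatible : Compatible π J
  lie_comm : ∀ (α : OneForm E M) (x : M),
    π.sharp x (lieForm Z (transpose J α) x - transpose J (lieForm Z α) x) = 0

end Structures

end PoissonNijenhuis

end

open scoped Topology

noncomputable section

namespace PoissonNijenhuis

variable {E : Type*} [NormedAddCommGroup E] [NormedSpace ℝ E]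
  {M : Type*} [TopologicalSpace M] [ChartedSpace E M]

/-! Only the last condition needs proof, and it holds before `π` is applied: `L_Z` commutes with
`ᵗJ`. By `lieForm_apply`, `(L_Z ᵗJα)(X) = Z(α(JX)) - α(J[Z,X])` and `(L_Z α)(JX) = Z(α(JX)) -
α([Z,JX])`; these agree because `[Z,JX] = J[Z,X]`. Global vector fields reach every tangent vector,
so the two forms are equal.

The formula in `lieForm_apply` is checked in the preferred chart at the point, where `dForm` is
defined: `dFun_form_apply` is the product rule there, and `bracket_eq_lieBracket` turns the bracket
into the one on `E`. -/

/-- Every tangent vector is the value of a global smooth vector field. -/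
theorem exists_vectorField_apply_eq [FiniteDimensional ℝ E] [T2Space M] [IsManifold 𝓘(ℝ, E) ∞ M]
    (x : M) (v : TangentSpace 𝓘(ℝ, E) x) : ∃ X : VectorField E M, X x = v := by
  obtain ⟨s, hs, hsX⟩ := FiberBundle.exists_contMDiffOn_extend (k := ∞) 𝓘(ℝ, E) E v
  -- The closed support of the bump lies in an open set where the local extension is smooth, so the
  -- product is smooth on all of `M`.
  obtain ⟨f, hf⟩ := (SmoothBumpFunction.nhds_basis_tsupport (I := 𝓘(ℝ, E)) x).mem_iff.1
    (interior_mem_nhds.2 hs)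
  refine ⟨⟨fun y => f y • FiberBundle.extend E v y, ?_⟩, ?_⟩
  · exact ContMDiffOn.smul_section_of_tsupport f.contMDiff.contMDiffOn isOpen_interior hf.2
      (hsX.mono interior_subset)
  · show f x • FiberBundle.extend E v x = v
    simp

/-! ### Forms, fields and brackets in the preferred chart -/

/-- The fibre of the tangent bundle at `x` is identified with `E` through this very chart, so no
chart factor appears at the centre. -/
theorem mfderiv_extChartAt_symm_self [IsManifold 𝓘(ℝ, E) 1 M] (x : M) :
    (mfderiv 𝓘(ℝ, E) 𝓘(ℝ, E) (extChartAt 𝓘(ℝ, E) x).symm (extChartAt 𝓘(ℝ, E) x x) : E →L[ℝ] E)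
      = ContinuousLinearMap.id ℝ E := by
  have h := mfderivWithin_range_extChartAt_symm (I := 𝓘(ℝ, E)) (x := x)
  simp only [modelWithCornersSelf_coe, Set.range_id, mfderivWithin_univ] at h
  exact h

theorem formInChart_self [IsManifold 𝓘(ℝ, E) 1 M]
    (α : ∀ x : M, TangentSpace 𝓘(ℝ, E) x →L[ℝ] ℝ) (x : M) :
    formInChart α x (extChartAt 𝓘(ℝ, E) x x) = α x := by
  -- The fibres over `z` and `x` are different types that both unfold to `E`; the equality is
  -- therefore stated in the model space.
  have h : ∀ z : M, z = x → (α z : E →L[ℝ] ℝ) = α x := by rintro _ rfl; rfl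
  exact (congrArg₂ (fun (a : E →L[ℝ] ℝ) (L : E →L[ℝ] E) => a.comp L)
    (h _ (extChartAt_to_inv (I := 𝓘(ℝ, E)) x)) (mfderiv_extChartAt_symm_self x)).trans (ContinuousLinearMap.comp_id _)

theorem dFun_eq_fderiv {f : M → ℝ} {x : M} (hf : MDifferentiableAt 𝓘(ℝ, E) 𝓘(ℝ, ℝ) f x) :
    (dFun f x : E →L[ℝ] ℝ) =
      fderiv ℝ (f ∘ (extChartAt 𝓘(ℝ, E) x).symm) (extChartAt 𝓘(ℝ, E) x x) := by
  unfold dFun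
  rw [hf.mfderiv]
  simp only [writtenInExtChartAt, extChartAt_model_space_eq_id, modelWithCornersSelf_coe,
    Set.range_id, fderivWithin_univ]
  rfl

/-- The expression of a vector field in the preferred chart at `x`. -/
def vectorInChart (X : ∀ x : M, TangentSpace 𝓘(ℝ, E) x) (x : M) : E → E :=
  VectorField.mpullback 𝓘(ℝ, E) 𝓘(ℝ, E) (extChartAt 𝓘(ℝ, E) x).symm X

theorem bracket_eq_lieBracket [IsManifold 𝓘(ℝ, E) 1 M]
    (X Y : ∀ x : M, TangentSpace 𝓘(ℝ, E) x) (x : M) :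
    bracket X Y x = VectorField.lieBracket ℝ (vectorInChart X x) (vectorInChart Y x)
      (extChartAt 𝓘(ℝ, E) x x) := by
  unfold bracket
  rw [← VectorField.mlieBracketWithin_univ, VectorField.mlieBracketWithin_apply,
    mfderiv_extChartAt_self]
  simp only [modelWithCornersSelf_coe, Set.range_id, Set.preimage_univ, Set.inter_univ,
    VectorField.mpullbackWithin_univ]
  refine (DFunLike.congr_fun (ContinuousLinearMap.inverse_id (R := ℝ) (M := E)) _).trans ?_
  exact congrFun (VectorField.lieBracketWithin_univ (𝕜 := ℝ) (V := vectorInChart X x)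
    (W := vectorInChart Y x)) _

theorem vectorInChart_self [IsManifold 𝓘(ℝ, E) 1 M] (X : ∀ x : M, TangentSpace 𝓘(ℝ, E) x) (x : M) :
    vectorInChart X x (extChartAt 𝓘(ℝ, E) x x) = X x := by
  have h : ∀ z : M, z = x → (X z : E) = X x := by rintro _ rfl; rfl
  have e : (mfderiv 𝓘(ℝ, E) 𝓘(ℝ, E) (extChartAt 𝓘(ℝ, E) x).symm
      (extChartAt 𝓘(ℝ, E) x x) : E →L[ℝ] E).inverse = ContinuousLinearMap.id ℝ E :=
    (congrArg (ContinuousLinearMap.inverse : (E →L[ℝ] E) → E →L[ℝ] E)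
      (mfderiv_extChartAt_symm_self x)).trans ContinuousLinearMap.inverse_id
  exact congrArg₂ (fun (L : E →L[ℝ] E) (w : E) => L w) e (h _ (extChartAt_to_inv (I := 𝓘(ℝ, E)) x))

theorem differentiableAt_vectorInChart [CompleteSpace E] [IsManifold 𝓘(ℝ, E) ∞ M]
    {X : ∀ x : M, TangentSpace 𝓘(ℝ, E) x} {x : M}
    (hX : ContMDiffAt 𝓘(ℝ, E) (𝓘(ℝ, E).prod 𝓘(ℝ, E)) ∞
      (fun y => Bundle.TotalSpace.mk' E y (X y)) x) :
    DifferentiableAt ℝ (vectorInChart X x) (extChartAt 𝓘(ℝ, E) x x) := by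
  have h := VectorField.contMDiffWithinAt_mpullbackWithin_extChartAt_symm (n := ∞) (m := 1)
    (s := Set.univ) ((hX.of_le (by simp)).contMDiffWithinAt) uniqueMDiffOn_univ (Set.mem_univ x)
    (by norm_cast)
  simp only [modelWithCornersSelf_coe, Set.range_id, Set.preimage_univ, Set.inter_univ,
    VectorField.mpullbackWithin_univ] at h
  have h' := h.contMDiffAt (extChartAt_target_mem_nhds x)
  rw [Bundle.contMDiffAt_section] at h'
  simpa [vectorInChart] using (contMDiffAt_iff_contDiffAt.1 h').differentiableAt one_ne_zero

/-- The form is composed with the derivative of the inverse chart and the field with the inverse of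
that derivative, so the two cancel in the pairing. -/
theorem formInChart_apply_vectorInChart [IsManifold 𝓘(ℝ, E) 1 M]
    (α : ∀ x : M, TangentSpace 𝓘(ℝ, E) x →L[ℝ] ℝ) (X : ∀ x : M, TangentSpace 𝓘(ℝ, E) x) (x : M)
    {y : E} (hy : y ∈ (extChartAt 𝓘(ℝ, E) x).target) :
    formInChart α x y (vectorInChart X x y) =
      α ((extChartAt 𝓘(ℝ, E) x).symm y) (X ((extChartAt 𝓘(ℝ, E) x).symm y)) := by
  have h := isInvertible_mfderivWithin_extChartAt_symm hy
  simp only [modelWithCornersSelf_coe, Set.range_id, mfderivWithin_univ] at h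
  unfold formInChart vectorInChart
  rw [VectorField.mpullback_apply]
  exact congrArg _ (h.self_apply_inverse _)

/-- Smoothness of a section of the cotangent bundle is tested on `inCoordinates`; this transfers it
to `formInChart`. The inverse trivialization of the tangent bundle is the derivative of the inverse
chart. -/
theorem formInChart_eq_inCoordinates [IsManifold 𝓘(ℝ, E) 1 M]
    (α : ∀ x : M, TangentSpace 𝓘(ℝ, E) x →L[ℝ] ℝ) (x : M)
    {y : E} (hy : y ∈ (extChartAt 𝓘(ℝ, E) x).target) :
    formInChart α x y =
      ContinuousLinearMap.inCoordinates E (TangentSpace 𝓘(ℝ, E)) ℝ (fun _ : M => ℝ)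
        x ((extChartAt 𝓘(ℝ, E) x).symm y) x ((extChartAt 𝓘(ℝ, E) x).symm y)
        (α ((extChartAt 𝓘(ℝ, E) x).symm y)) := by
  have hz := (extChartAt 𝓘(ℝ, E) x).map_target hy
  rw [extChartAt_source] at hz
  have e := TangentBundle.symmL_trivializationAt (I := 𝓘(ℝ, E)) hz
  rw [(extChartAt 𝓘(ℝ, E) x).right_inv hy] at e
  simp only [modelWithCornersSelf_coe, Set.range_id, mfderivWithin_univ] at e
  unfold ContinuousLinearMap.inCoordinates formInChart
  rw [e]
  ext v
  exact (DFunLike.congr_fun (Bundle.Trivial.continuousLinearMapAt_trivialization ℝ M ℝ _) _).symm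

theorem differentiableAt_formInChart [IsManifold 𝓘(ℝ, E) ∞ M]
    {α : ∀ x : M, TangentSpace 𝓘(ℝ, E) x →L[ℝ] ℝ} {x : M}
    (hα : ContMDiffAt 𝓘(ℝ, E) (𝓘(ℝ, E).prod 𝓘(ℝ, E →L[ℝ] ℝ)) ∞
      (fun y => Bundle.TotalSpace.mk' (E →L[ℝ] ℝ)
        (E := fun y : M => TangentSpace 𝓘(ℝ, E) y →L[ℝ] ℝ) y (α y)) x) :
    DifferentiableAt ℝ (formInChart α x) (extChartAt 𝓘(ℝ, E) x x) := by
  rw [contMDiffAt_hom_bundle] at hα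
  have h := hα.2
  have hs : ContMDiffAt 𝓘(ℝ, E) 𝓘(ℝ, E) ∞ (extChartAt 𝓘(ℝ, E) x).symm (extChartAt 𝓘(ℝ, E) x x) :=
    (contMDiffOn_extChartAt_symm x).contMDiffAt (extChartAt_target_mem_nhds x)
  have h' := (contMDiffAt_iff_contDiffAt.1 (h.comp_of_eq hs (extChartAt_to_inv x))).differentiableAt
    (by simp)
  refine h'.congr_of_eventuallyEq ?_
  filter_upwards [extChartAt_target_mem_nhds x] with y hy
  exact formInChart_eq_inCoordinates α x hy

/-- In coordinates the transpose is a composition of the two coordinate expressions: the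
trivialization of `TM` and its inverse cancel in the middle over the base set. -/
theorem contMDiffAt_transpose [IsManifold 𝓘(ℝ, E) ∞ M]
    {J : ∀ x : M, TangentSpace 𝓘(ℝ, E) x →L[ℝ] TangentSpace 𝓘(ℝ, E) x}
    {α : ∀ x : M, TangentSpace 𝓘(ℝ, E) x →L[ℝ] ℝ} {x : M}
    (hJ : ContMDiffAt 𝓘(ℝ, E) (𝓘(ℝ, E).prod 𝓘(ℝ, E →L[ℝ] E)) ∞
      (fun y => Bundle.TotalSpace.mk' (E →L[ℝ] E)
        (E := fun y : M => TangentSpace 𝓘(ℝ, E) y →L[ℝ] TangentSpace 𝓘(ℝ, E) y) y (J y)) x)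
    (hα : ContMDiffAt 𝓘(ℝ, E) (𝓘(ℝ, E).prod 𝓘(ℝ, E →L[ℝ] ℝ)) ∞
      (fun y => Bundle.TotalSpace.mk' (E →L[ℝ] ℝ)
        (E := fun y : M => TangentSpace 𝓘(ℝ, E) y →L[ℝ] ℝ) y (α y)) x) :
    ContMDiffAt 𝓘(ℝ, E) (𝓘(ℝ, E).prod 𝓘(ℝ, E →L[ℝ] ℝ)) ∞
      (fun y => Bundle.TotalSpace.mk' (E →L[ℝ] ℝ)
        (E := fun y : M => TangentSpace 𝓘(ℝ, E) y →L[ℝ] ℝ) y (transpose J α y)) x := by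
  rw [contMDiffAt_hom_bundle] at hJ hα ⊢
  refine ⟨contMDiffAt_id, (hα.2.clm_comp hJ.2).congr_of_eventuallyEq ?_⟩
  filter_upwards [(trivializationAt E (TangentSpace 𝓘(ℝ, E)) x).open_baseSet.mem_nhds
    (FiberBundle.mem_baseSet_trivializationAt' x)] with y hy
  ext v
  simp only [ContinuousLinearMap.inCoordinates, ContinuousLinearMap.comp_apply, transpose]
  rw [Bundle.Trivialization.symmL_continuousLinearMapAt _ hy]

theorem mdifferentiableAt_form_apply [IsManifold 𝓘(ℝ, E) ∞ M]
    {α : ∀ x : M, TangentSpace 𝓘(ℝ, E) x →L[ℝ] ℝ} {X : ∀ x : M, TangentSpace 𝓘(ℝ, E) x} {x : M}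
    (hα : ContMDiffAt 𝓘(ℝ, E) (𝓘(ℝ, E).prod 𝓘(ℝ, E →L[ℝ] ℝ)) ∞
      (fun y => Bundle.TotalSpace.mk' (E →L[ℝ] ℝ)
        (E := fun y : M => TangentSpace 𝓘(ℝ, E) y →L[ℝ] ℝ) y (α y)) x)
    (hX : ContMDiffAt 𝓘(ℝ, E) (𝓘(ℝ, E).prod 𝓘(ℝ, E)) ∞
      (fun y => Bundle.TotalSpace.mk' E y (X y)) x) :
    MDifferentiableAt 𝓘(ℝ, E) 𝓘(ℝ, ℝ) (fun y => α y (X y)) x := by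
  have h := ContMDiffAt.clm_bundle_apply (E₂ := fun _ : M => ℝ) hα hX
  rw [Bundle.contMDiffAt_section] at h
  exact h.mdifferentiableAt (by simp)

/-! ### The Lie derivative of a 1-form and its commutation with the transpose -/

/-- The differential of `⟨α, X⟩`, computed in the preferred chart. -/
theorem dFun_form_apply [CompleteSpace E] [IsManifold 𝓘(ℝ, E) ∞ M]
    {α : ∀ x : M, TangentSpace 𝓘(ℝ, E) x →L[ℝ] ℝ} {X : ∀ x : M, TangentSpace 𝓘(ℝ, E) x} {x : M}
    (hα : ContMDiffAt 𝓘(ℝ, E) (𝓘(ℝ, E).prod 𝓘(ℝ, E →L[ℝ] ℝ)) ∞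
      (fun y => Bundle.TotalSpace.mk' (E →L[ℝ] ℝ)
        (E := fun y : M => TangentSpace 𝓘(ℝ, E) y →L[ℝ] ℝ) y (α y)) x)
    (hX : ContMDiffAt 𝓘(ℝ, E) (𝓘(ℝ, E).prod 𝓘(ℝ, E)) ∞
      (fun y => Bundle.TotalSpace.mk' E y (X y)) x) (v : E) :
    (dFun (fun y => α y (X y)) x : E →L[ℝ] ℝ) v =
      fderiv ℝ (formInChart α x) (extChartAt 𝓘(ℝ, E) x x) v (X x) +
        (α x : E →L[ℝ] ℝ) (fderiv ℝ (vectorInChart X x) (extChartAt 𝓘(ℝ, E) x x) v) := by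
  have : IsManifold 𝓘(ℝ, E) 1 M := IsManifold.of_le (n := ∞) (by simp)
  rw [dFun_eq_fderiv (mdifferentiableAt_form_apply hα hX)]
  have h : ((fun y => α y (X y)) ∘ (extChartAt 𝓘(ℝ, E) x).symm)
      =ᶠ[𝓝 (extChartAt 𝓘(ℝ, E) x x)] fun y => formInChart α x y (vectorInChart X x y) := by
    filter_upwards [extChartAt_target_mem_nhds x] with y hy
    exact (formInChart_apply_vectorInChart α X x hy).symm
  rw [h.fderiv_eq, fderiv_clm_apply (differentiableAt_formInChart hα)
    (differentiableAt_vectorInChart hX), formInChart_self, vectorInChart_self]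
  exact add_comm _ _

/-- The Lie derivative of a 1-form, evaluated on a vector field:
`(L_Z α)(X) = Z(α(X)) - α([Z, X])`. -/
theorem lieForm_apply [CompleteSpace E] [IsManifold 𝓘(ℝ, E) ∞ M]
    {α : ∀ x : M, TangentSpace 𝓘(ℝ, E) x →L[ℝ] ℝ} {X Z : ∀ x : M, TangentSpace 𝓘(ℝ, E) x} {x : M}
    (hα : ContMDiffAt 𝓘(ℝ, E) (𝓘(ℝ, E).prod 𝓘(ℝ, E →L[ℝ] ℝ)) ∞
      (fun y => Bundle.TotalSpace.mk' (E →L[ℝ] ℝ)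
        (E := fun y : M => TangentSpace 𝓘(ℝ, E) y →L[ℝ] ℝ) y (α y)) x)
    (hZ : ContMDiffAt 𝓘(ℝ, E) (𝓘(ℝ, E).prod 𝓘(ℝ, E)) ∞
      (fun y => Bundle.TotalSpace.mk' E y (Z y)) x)
    (hX : ContMDiffAt 𝓘(ℝ, E) (𝓘(ℝ, E).prod 𝓘(ℝ, E)) ∞
      (fun y => Bundle.TotalSpace.mk' E y (X y)) x) :
    lieForm Z α x (X x) = dFun (fun y => α y (X y)) x (Z x) - α x (bracket Z X x) := by
  have : IsManifold 𝓘(ℝ, E) 1 M := IsManifold.of_le (n := ∞) (by simp)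
  have hd : dForm α x (Z x) (X x) =
      fderiv ℝ (formInChart α x) (extChartAt 𝓘(ℝ, E) x x) (Z x) (X x) -
        fderiv ℝ (formInChart α x) (extChartAt 𝓘(ℝ, E) x x) (X x) (Z x) := by
    have e : (mfderiv 𝓘(ℝ, E) 𝓘(ℝ, E) (extChartAt 𝓘(ℝ, E) x) x : E →L[ℝ] E) =
        ContinuousLinearMap.id ℝ E := mfderiv_extChartAt_self
    unfold dForm
    dsimp only
    erw [e]
    rfl
  have hb : (α x : E →L[ℝ] ℝ) (bracket Z X x) =
      (α x : E →L[ℝ] ℝ) (fderiv ℝ (vectorInChart X x) (extChartAt 𝓘(ℝ, E) x x) (Z x)) -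
      (α x : E →L[ℝ] ℝ) (fderiv ℝ (vectorInChart Z x) (extChartAt 𝓘(ℝ, E) x x) (X x)) := by
    rw [bracket_eq_lieBracket, VectorField.lieBracket, vectorInChart_self, vectorInChart_self]
    exact map_sub (α x : E →L[ℝ] ℝ) _ _
  have h1 := dFun_form_apply hα hX (Z x)
  have h2 := dFun_form_apply hα hZ (X x)
  calc lieForm Z α x (X x) = dForm α x (Z x) (X x) + dFun (fun y => α y (Z y)) x (X x) := rfl
    _ = _ := by
      -- Writing `D` for derivatives in the chart, `Dα(X)(Z)` cancels between `dα(Z, X)` and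
      -- `d(α(Z))(X)`, and `α(DX(Z))` cancels on the other side. Both sides reduce to `Dα(Z)(X) +
      -- α(DZ(X))`.
      refine (congrArg₂ (· + ·) hd h2).trans (Eq.trans ?_ (congrArg₂ (· - ·) h1 hb).symm)
      ring

/-- If `L_Z J = 0`, then `L_Z` commutes with the transpose of `J` on 1-forms. -/
theorem lieForm_transpose [FiniteDimensional ℝ E] [T2Space M] [IsManifold 𝓘(ℝ, E) ∞ M]
    (J : TensorField E M) (Z : VectorField E M)
    (hJ : ∀ (X : VectorField E M) (x : M),
      bracket Z (fun y => J y (X y)) x = J x (bracket Z X x)) (α : OneForm E M) (x : M) :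
    lieForm Z (transpose J α) x = transpose J (lieForm Z α) x := by
  have : CompleteSpace E := FiniteDimensional.complete ℝ E
  ext v
  -- Both sides are covectors at `x`, so any extension of `v` will do; it must be global because
  -- `hJ` concerns global fields.
  obtain ⟨X, rfl⟩ := exists_vectorField_apply_eq x v
  have hJX := (J.contMDiff x).clm_bundle_apply (X.contMDiff x)
  have h1 := lieForm_apply (contMDiffAt_transpose (J.contMDiff x) (α.contMDiff x))
    (Z.contMDiff x) (X.contMDiff x)
  -- The function `α(JX)` differentiated here is by definition `(ᵗJα)(X)`, the one in `h1`, so only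
  -- the bracket terms need `hJ`.
  have h2 := lieForm_apply (α.contMDiff x) (Z.contMDiff x) hJX
  rw [hJ] at h2
  exact h1.trans h2.symm

end PoissonNijenhuis

end

theorem mainTheorem9
    {E : Type*} [NormedAddCommGroup E] [NormedSpace ℝ E] [FiniteDimensional ℝ E]
    {M : Type*} [TopologicalSpace M] [T2Space M] [ChartedSpace E M] [IsManifold 𝓘(ℝ, E) ∞ M]
    (π : PoissonNijenhuis.BivectorField E M) (J : PoissonNijenhuis.TensorField E M)
    (Z : PoissonNijenhuis.VectorField E M)
    (hPN : PoissonNijenhuis.IsPoissonNijenhuis π J)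
    (hZ : PoissonNijenhuis.IsHomogeneous π Z)
    (hJ : ∀ (X : PoissonNijenhuis.VectorField E M) (x : M),
      PoissonNijenhuis.bracket Z (fun y => J y (X y)) x =
        J x (PoissonNijenhuis.bracket Z X x)) :
    PoissonNijenhuis.IsHomogeneousPoissonNijenhuis π J Z where
  homogeneousPoisson := ⟨hPN.poisson, hZ⟩
  nijenhuis := hPN.nijenhuis
  compatible := hPN.compatible
  lie_comm α x := by
    rw [PoissonNijenhuis.lieForm_transpose J Z hJ α x, sub_self, map_zero]
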